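/- Let $\mathcal F$ be the set of multi-indices $\boldsymbol\nu=(\nu_m)_{m\in\mathbb N}$ of nonnegative integers with finitely many nonzero entries, ordered componentwise; $\Lambda\subset\mathcal F$ is *monotone* if $\boldsymbol\nu\in\Lambda$ and $\tilde{\boldsymbol\nu}\le\boldsymbol\nu$ imply $\tilde{\boldsymbol\nu}\in\Lambda$. Let $\mu=\bigotimes_{m}N(0,1)$ on $\mathbb R^{\mathbb N}$, let $H_n$ be the univariate Hermite polynomial of degree $n$, orthonormal with respect to $N(0,1)$, and let $H_{\boldsymbol\nu}(\boldsymbol\xi)=\prod_m H_{\nu_m}(\xi_m)$. For each $k\ge 0$ let $\Xi^{(k)}=\{\xi^{(k)}_0,\dots,\xi^{(k)}_k\}\subset\mathbb R$ consist of $k+1$ distinct nodes, let $U_k$ be Lagrange interpolation at $\Xi^{(k)}$, $U_{-1}=0$, and $\Delta_k=U_k-U_{k-1}$. For $\mathbf k\in\mathcal F$ put $\Xi^{(\mathbf k)}=\prod_m\Xi^{(k_m)}$ and $\Delta_{\mathbf k}=\bigotimes_m\Delta_{k_m}$, and for finite $\Lambda\subset\mathcal F$ let $U_\Lambda=\sum_{\mathbf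 i\in\Lambda}\Delta_{\mathbf i}$ be the sparse collocation operator. Put $$c_{\boldsymbol\nu}=\sup_{\Lambda\subset\mathcal F,\ |\Lambda|<\infty}\|(I-U_\Lambda)H_{\boldsymbol\nu}\|_{L^2_\mu}.$$ Let $\mathcal H$ be a separable real Hilbert space and let $\Gamma\subset\mathbb R^{\mathbb N}$ satisfy $\mu(\Gamma)=1$ and $\Xi^{(\mathbf k)}\subset\Gamma$ for all $\mathbf k\in\mathcal F$. Let $f:\Gamma\to\mathcal H$ (extended to $\mathbb R^{\mathbb N}$) belong to $L^2_\mu(\mathbb R^{\mathbb N};\mathcal H)$, with Hermite coefficients $f_{\boldsymbol\nu}=\int f H_{\boldsymbol\nu}\,d\mu$, and suppose that the Hermite expansion represents the point values of $f$ at all grid nodes: for every $\mathbf k\in\mathcal F$ and every $\boldsymbol\xi\in\Xi^{(\mathbf k)}$, $$f(\boldsymbol\xi)=\sum_{\boldsymbol\nu\in\mathcal F}f_{\boldsymbol\nu}H_{\boldsymbol\nu}(\boldsymbol\xi)$$ with unconditional convergence in $\mathcal H$. **Theorem.** Let $p\in(0,1)$ and let $(\hat c_{\boldsymbol\nu})_{\boldsymbol\nu\in\mathcal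 F}\in\ell^p(\mathcal F)$ be real and nonincreasing (that is, $\boldsymbol\nu\le\tilde{\boldsymbol\nu}$ implies $\hat c_{\boldsymbol\nu}\ge\hat c_{\tilde{\boldsymbol\nu}}$) with $$c_{\boldsymbol\nu}\,\|f_{\boldsymbol\nu}\|_{\mathcal H}\le\hat c_{\boldsymbol\nu}\qquad\text{for all }\boldsymbol\nu\in\mathcal F.$$ Then there are a nested sequence $\Lambda_0\subset\Lambda_1\subset\cdots$ of finite monotone subsets of $\mathcal F$ with $|\Lambda_N|=N$ and a constant $C<\infty$ such that $$\|f-U_{\Lambda_N}f\|_{L^2_\mu}\le C\,(N+1)^{-(1/p-1)}\qquad\text{for all }N\ge 0.$$ -/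

import Mathlib

open MeasureTheory ProbabilityTheory

noncomputable section

namespace SparseCollocation

/-- Multi-indices: sequences of natural numbers with finitely many nonzero entries, with the
componentwise order. -/
abbrev MultiIndex : Type := ℕ →₀ ℕ

/-- The countable product of standard Gaussian measures on `ℝ`. -/
def gaussianProd : Measure (ℕ → ℝ) := Measure.infinitePi fun _ : ℕ => gaussianReal 0 1

/-- The orthonormal Hermite polynomial of degree `n` for the standard Gaussian measure. -/
def hermiteFun (n : ℕ) (t : ℝ) : ℝ :=
  Polynomial.aeval t (Polynomial.hermite n) / Real.sqrt (n.factorial : ℝ)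

/-- The multivariate Hermite polynomial `∏ m, H_{ν m} (x m)`; the factors with `ν m = 0` are
equal to one, so that the product runs over the support of `ν`. -/
def multiHermite (ν : MultiIndex) (x : ℕ → ℝ) : ℝ :=
  ∏ m ∈ ν.support, hermiteFun (ν m) (x m)

section Operators

/- The interpolation nodes of level `k` are `ξ k 0, …, ξ k k`; the values `ξ k i` with `i > k`
are never used. -/
variable (ξ : ℕ → ℕ → ℝ)

/-- The set of the `k + 1` univariate nodes of level `k`. -/
def nodeSet (k : ℕ) : Set ℝ := {t | ∃ i ≤ k, t = ξ k i}

/-- The Cartesian product `Ξ^(k)` of the univariate node sets of levels `k m`. -/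
def tensorGrid (k : MultiIndex) : Set (ℕ → ℝ) := {x | ∀ m, x m ∈ nodeSet ξ (k m)}

/-- The point of `Ξ^(k)` with index `i ≤ k`. -/
def gridPoint (k i : MultiIndex) : ℕ → ℝ := fun m => ξ (k m) (i m)

/-- The univariate Lagrange fundamental polynomial with index `i` for the nodes
`ξ k 0, …, ξ k k`. -/
def lagrangePoly (k i : ℕ) : Polynomial ℝ :=
  Lagrange.basis (Finset.range (k + 1)) (ξ k) i

/-- The multivariate Lagrange polynomial `∏ m, L_{i m}^(k m) (x m)`, for `i ≤ k`; the factors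
with `k m = 0` are equal to one. -/
def tensorLagrange (k i : MultiIndex) (x : ℕ → ℝ) : ℝ :=
  ∏ m ∈ k.support, (lagrangePoly ξ (k m) (i m)).eval (x m)

variable {E : Type*} [AddCommGroup E] [Module ℝ E]

/-- The full tensor product interpolation operator `U_k`. -/
def tensorInterp (k : MultiIndex) (g : (ℕ → ℝ) → E) (x : ℕ → ℝ) : E :=
  ∑ i ∈ Finset.Iic k, tensorLagrange ξ k i x • g (gridPoint ξ k i)

/-- The tensorized detail operator `Δ_i = ⨂ m, (U_{i m} - U_{i m - 1})`, where `U_{-1} = 0`,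
expanded by multilinearity as `∑ (-1)^|i - k| U_k` over all multi-indices `k` such that
`i m - 1 ≤ k m ≤ i m` for every `m`; terms with an entry `-1` vanish. -/
def detailOp (i : MultiIndex) (g : (ℕ → ℝ) → E) (x : ℕ → ℝ) : E :=
  ∑ k ∈ Finset.Icc (i.mapRange Nat.pred rfl) i,
    (-1 : ℝ) ^ (i - k).degree • tensorInterp ξ k g x

/-- The sparse collocation operator `U_Λ = ∑ i ∈ Λ, Δ_i`. -/
def sparseColloc (Λ : Finset MultiIndex) (g : (ℕ → ℝ) → E) (x : ℕ → ℝ) : E :=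
  ∑ i ∈ Λ, detailOp ξ i g x

/-- The worst-case error `c_ν = sup_Λ ‖(I - U_Λ) H_ν‖`, with the `L²` norm and the supremum over
all finite sets `Λ` of multi-indices. -/
def worstError (ν : MultiIndex) : ENNReal :=
  ⨆ Λ : Finset MultiIndex,
    eLpNorm (fun x => multiHermite ν x - sparseColloc ξ Λ (multiHermite ν) x) 2 gaussianProd

end Operators

/-- The extension by zero of a function on `Γ` to the space of all real sequences. -/
def extendZero {H : Type*} [Zero H] {Γ : Set (ℕ → ℝ)} (f : Γ → H) : (ℕ → ℝ) → H :=
  Function.extend Subtype.val f 0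

/-- The Hermite coefficient `f_ν = ∫ f H_ν` of a function on `Γ`. -/
def hermiteCoeff {H : Type*} [NormedAddCommGroup H] [NormedSpace ℝ H] {Γ : Set (ℕ → ℝ)}
    (f : Γ → H) (ν : MultiIndex) : H :=
  ∫ x, multiHermite ν x • extendZero f x ∂gaussianProd

end SparseCollocation

end

open MeasureTheory SparseCollocation

/-! Taking `Λ = ∅` shows `c_ν ≥ 1`, so `‖f_ν‖ ≤ ĉ_ν`, and the coefficients are summable because `ℓ^p
⊂ ℓ^1`. Completeness of the Hermite system then makes the Hermite series converge to `f` almost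
everywhere (`ae_hasSum_hermite`). At the nodes it represents `f` by hypothesis, so `U_Λ`, a finite
combination of point evaluations, acts on it termwise (`hasSum_sparseColloc`).

For monotone `Λ` the operator `U_Λ` is exact on `H_ν` with `ν ∈ Λ` (`sparseColloc_multiHermite`):
only the details below `ν` act on `H_ν`, and they telescope in each coordinate. Hence `f - U_Λ f` is
the sum of `f_ν (I - U_Λ) H_ν` over `ν ∉ Λ`, with norm at most the sum of `ĉ_ν` over `ν ∉ Λ`
(`eLpNorm_sub_sparseColloc_le`).

Since `ĉ` is nonincreasing, its `N` largest terms can be selected so that the index sets are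
monotone and nested (`exists_nested_largest`). Stechkin's inequality bounds the remaining tail, with
the `ℓ^p` quasi-norm of `ĉ` as constant. -/

namespace SparseCollocation

/-! ### Univariate Hermite polynomials: orthonormality and recurrence. -/

section Univariate

open Polynomial

theorem integrable_eval_gaussianReal (q : ℝ[X]) :
    Integrable (fun t => q.eval t) (gaussianReal 0 1) := by
  induction q using Polynomial.induction_on' with
  | add q r hq hr => exact (hq.add hr).congr (ae_of_all _ fun t => by simp)
  | monomial n a =>
    have h : Integrable (fun t : ℝ => t ^ n) (gaussianReal 0 1) := by
      have := (memLp_id_gaussianReal (μ := 0) (v := 1) n)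
      refine (integrable_norm_iff (by fun_prop)).1 ?_
      simpa using this.integrable_norm_pow'
    simpa using h.const_mul a

theorem memLp_two_eval_gaussianReal (q : ℝ[X]) :
    MemLp (fun t => q.eval t) 2 (gaussianReal 0 1) := by
  refine (memLp_two_iff_integrable_sq (by fun_prop)).2 ?_
  exact (integrable_eval_gaussianReal (q ^ 2)).congr (ae_of_all _ fun t => eval_pow 2)

theorem hasDerivAt_gaussianPDFReal_std (t : ℝ) :
    HasDerivAt (gaussianPDFReal 0 1) (-t * gaussianPDFReal 0 1 t) t := by
  unfold gaussianPDFReal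
  have h : HasDerivAt (fun x : ℝ => -(x - 0) ^ 2 / (2 * ((1 : NNReal) : ℝ))) (-t) t := by
    have := (((hasDerivAt_id t).sub_const 0).pow 2).neg.div_const (2 * ((1 : NNReal) : ℝ))
    exact this.congr_deriv (by simp; ring)
  refine (h.exp.const_mul _).congr_deriv ?_
  ring

theorem integrable_mul_gaussianPDFReal {g : ℝ → ℝ} (hg : Integrable g (gaussianReal 0 1)) :
    Integrable (fun t => g t * gaussianPDFReal 0 1 t) := by
  rw [gaussianReal_of_var_ne_zero _ one_ne_zero,
    integrable_withDensity_iff (measurable_gaussianPDF 0 1)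
      (ae_of_all _ fun _ => gaussianPDF_lt_top)] at hg
  simpa [toReal_gaussianPDF] using hg

/-- Gaussian integration by parts for polynomials. -/
theorem integral_X_mul_sub_derivative (q : ℝ[X]) :
    ∫ t, (X * q - derivative q).eval t ∂gaussianReal 0 1 = 0 := by
  rw [integral_gaussianReal_eq_integral_smul (one_ne_zero : (1 : NNReal) ≠ 0)]
  have hd : ∀ t, HasDerivAt (fun t => q.eval t * gaussianPDFReal 0 1 t)
      ((derivative q - X * q).eval t * gaussianPDFReal 0 1 t) t := by
    intro t
    refine ((q.hasDerivAt t).mul (hasDerivAt_gaussianPDFReal_std t)).congr_deriv ?_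
    simp only [eval_sub, eval_mul, eval_X]
    ring
  have key := integral_eq_zero_of_hasDerivAt_of_integrable hd
    (integrable_mul_gaussianPDFReal (integrable_eval_gaussianReal _))
    (integrable_mul_gaussianPDFReal (integrable_eval_gaussianReal _))
  rw [← neg_eq_zero, ← integral_neg]
  refine (integral_congr_ae (ae_of_all _ fun t => ?_)).trans key
  simp only [eval_sub, eval_mul, eval_X, smul_eq_mul]
  ring

/-- The probabilists' Hermite polynomial with real coefficients. -/
noncomputable def hermiteReal (n : ℕ) : ℝ[X] := (hermite n).map (Int.castRingHom ℝ)

theorem hermiteReal_zero : hermiteReal 0 = 1 := by simp [hermiteReal]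

theorem hermiteReal_succ (n : ℕ) :
    hermiteReal (n + 1) = X * hermiteReal n - derivative (hermiteReal n) := by
  simp [hermiteReal, hermite_succ, derivative_map]

theorem monic_hermiteReal (n : ℕ) : (hermiteReal n).Monic := (hermite_monic n).map _

theorem natDegree_hermiteReal (n : ℕ) : (hermiteReal n).natDegree = n := by
  rw [hermiteReal, (hermite_monic n).natDegree_map, natDegree_hermite]

theorem derivative_hermiteReal_succ (n : ℕ) :
    derivative (hermiteReal (n + 1)) = ((n : ℝ[X]) + 1) * hermiteReal n := by
  induction n with
  | zero => simp [hermiteReal_succ, hermiteReal_zero]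
  | succ n ih =>
    rw [hermiteReal_succ (n + 1), derivative_sub, derivative_mul, ih, derivative_mul]
    simp only [derivative_X, derivative_add, derivative_natCast, derivative_one]
    rw [hermiteReal_succ n]
    push_cast
    ring

/-- The Gaussian adjoint of `q ↦ X * q - q'` is differentiation, so each raising step in
`hermiteReal` moves onto `q` as a derivative. -/
theorem integral_hermiteReal_mul (n : ℕ) (q : ℝ[X]) :
    ∫ t, (hermiteReal n * q).eval t ∂gaussianReal 0 1
      = ∫ t, (derivative^[n] q).eval t ∂gaussianReal 0 1 := by
  induction n generalizing q with
  | zero => simp [hermiteReal_zero]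
  | succ n ih =>
    rw [Function.iterate_succ_apply, ← ih, ← sub_eq_zero,
      ← integral_sub (integrable_eval_gaussianReal _) (integrable_eval_gaussianReal _)]
    refine (integral_congr_ae (ae_of_all _ fun t => ?_)).trans
      (integral_X_mul_sub_derivative (hermiteReal n * q))
    simp [hermiteReal_succ]
    ring

theorem integral_hermiteReal_mul_hermiteReal (n m : ℕ) :
    ∫ t, (hermiteReal n * hermiteReal m).eval t ∂gaussianReal 0 1
      = if n = m then (n.factorial : ℝ) else 0 := by
  wlog h : m ≤ n generalizing n m
  · rw [mul_comm, this m n (by omega), if_neg (by omega), if_neg (by omega)]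
  rw [integral_hermiteReal_mul]
  rcases h.lt_or_eq with h | rfl
  · rw [if_neg (by omega), iterate_derivative_eq_zero (by rwa [natDegree_hermiteReal])]
    simp
  -- The `m`-th derivative of a monic polynomial of degree `m` is the constant `m!`.
  · rw [if_pos rfl]
    have h0 : (derivative^[m] (hermiteReal m)) = C (m.factorial : ℝ) := by
      have hd : (derivative^[m] (hermiteReal m)).natDegree ≤ 0 := by
        simpa [natDegree_hermiteReal] using natDegree_iterate_derivative (hermiteReal m) m
      rw [eq_C_of_natDegree_le_zero hd, coeff_iterate_derivative]
      have h1 : (hermiteReal m).coeff m = 1 := by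
        simpa [natDegree_hermiteReal] using (monic_hermiteReal m).coeff_natDegree
      simp [h1, Nat.descFactorial_self]
    simp [h0]

/-- The orthonormal Hermite polynomial. -/
noncomputable def hermitePoly (n : ℕ) : ℝ[X] :=
  C (Real.sqrt (n.factorial : ℝ))⁻¹ * hermiteReal n

theorem eval_hermitePoly (n : ℕ) (t : ℝ) : (hermitePoly n).eval t = hermiteFun n t := by
  simp [hermitePoly, hermiteFun, hermiteReal, aeval_def, eval_map]
  ring

theorem hermiteFun_zero (t : ℝ) : hermiteFun 0 t = 1 := by simp [hermiteFun]

theorem continuous_hermiteFun (n : ℕ) : Continuous (hermiteFun n) := by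
  simpa only [eval_hermitePoly] using (hermitePoly n).continuous

theorem degree_hermitePoly_lt {n k : ℕ} (h : n ≤ k) : (hermitePoly n).degree < (k + 1 : ℕ) := by
  refine (degree_le_natDegree.trans (Nat.cast_le.2 ((natDegree_C_mul_le _ _).trans
    (natDegree_hermiteReal n).le))).trans_lt ?_
  exact Nat.cast_lt.2 (Nat.lt_succ_of_le h)

theorem memLp_two_hermiteFun (n : ℕ) : MemLp (hermiteFun n) 2 (gaussianReal 0 1) := by
  simpa only [eval_hermitePoly] using memLp_two_eval_gaussianReal (hermitePoly n)

theorem integral_hermiteFun_mul_hermiteFun (n m : ℕ) :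
    ∫ t, hermiteFun n t * hermiteFun m t ∂gaussianReal 0 1 = if n = m then 1 else 0 := by
  have h : ∀ t, hermiteFun n t * hermiteFun m t =
      ((Real.sqrt (n.factorial : ℝ))⁻¹ * (Real.sqrt (m.factorial : ℝ))⁻¹) *
        (hermiteReal n * hermiteReal m).eval t := by
    intro t
    rw [← eval_hermitePoly, ← eval_hermitePoly]
    simp [hermitePoly]
    ring
  simp_rw [h]
  rw [integral_const_mul, integral_hermiteReal_mul_hermiteReal]
  split_ifs with hnm
  · subst hnm
    have h0 : (0 : ℝ) < n.factorial := by exact_mod_cast n.factorial_pos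
    rw [← mul_inv, Real.mul_self_sqrt h0.le, inv_mul_cancel₀ h0.ne']
  · simp

/-- Multiplication by the variable maps Hermite polynomials to combinations of two of them. -/
theorem exists_mul_hermiteFun (n : ℕ) : ∃ a b : ℝ, ∀ t, t * hermiteFun n t =
    a * hermiteFun (n + 1) t + b * hermiteFun (n - 1) t := by
  have hne : ∀ k : ℕ, Real.sqrt (k.factorial : ℝ) ≠ 0 := fun k =>
    (Real.sqrt_pos.2 (by exact_mod_cast k.factorial_pos)).ne'
  have hH : ∀ k t, (hermiteReal k).eval t = Real.sqrt (k.factorial : ℝ) * hermiteFun k t := by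
    intro k t
    rw [← eval_hermitePoly, hermitePoly, eval_mul, eval_C, mul_inv_cancel_left₀ (hne k)]
  have hF : ∀ k t, hermiteFun k t = (Real.sqrt (k.factorial : ℝ))⁻¹ * (hermiteReal k).eval t := by
    intro k t
    rw [hH, inv_mul_cancel_left₀ (hne k)]
  rcases n with _ | n
  -- Here `n - 1` truncates to `0`; the coefficient `0` removes that spurious term.
  · refine ⟨1, 0, fun t => ?_⟩
    simp [hermiteFun]
  · refine ⟨(Real.sqrt ((n + 1).factorial : ℝ))⁻¹ * Real.sqrt ((n + 2).factorial : ℝ),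
      (Real.sqrt ((n + 1).factorial : ℝ))⁻¹ * (n + 1) * Real.sqrt (n.factorial : ℝ), fun t => ?_⟩
    have h := congrArg (eval t) (hermiteReal_succ (n + 1))
    rw [derivative_hermiteReal_succ] at h
    simp only [eval_sub, eval_mul, eval_X, eval_add, eval_natCast, eval_one] at h
    rw [mul_assoc _ _ (hermiteFun (n + 1 + 1) t), ← hH, mul_assoc _ _ (hermiteFun (n + 1 - 1) t),
      Nat.add_sub_cancel, ← hH, h, hF (n + 1)]
    ring

end Univariate

/-! ### Orthonormality of the multivariate Hermite polynomials. -/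

section Multivariate

instance : IsProbabilityMeasure gaussianProd := by
  unfold gaussianProd
  infer_instance

theorem multiHermite_eq_prod {ν : MultiIndex} {J : Finset ℕ} (h : ν.support ⊆ J) (x : ℕ → ℝ) :
    multiHermite ν x = ∏ m ∈ J, hermiteFun (ν m) (x m) :=
  Finset.prod_subset h fun m _ hm => by
    rw [Finsupp.notMem_support_iff.1 hm, hermiteFun_zero]

theorem multiHermite_zero (x : ℕ → ℝ) : multiHermite 0 x = 1 := by simp [multiHermite]

theorem continuous_multiHermite (ν : MultiIndex) : Continuous (multiHermite ν) :=
  continuous_finsetProd _ fun m _ => (continuous_hermiteFun _).comp (continuous_apply m)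

theorem map_restrict_gaussianProd (J : Finset ℕ) :
    gaussianProd.map J.restrict = Measure.pi fun _ : J => gaussianReal 0 1 :=
  Measure.infinitePi_map_restrict _

theorem integrable_prod_gaussianProd {J : Finset ℕ} {φ : ℕ → ℝ → ℝ}
    (hφ : ∀ m, Integrable (φ m) (gaussianReal 0 1)) :
    Integrable (fun x : ℕ → ℝ => ∏ m ∈ J, φ m (x m)) gaussianProd := by
  have h : Integrable (fun y : J → ℝ => ∏ m : J, φ m (y m))
      (gaussianProd.map J.restrict) := by
    rw [map_restrict_gaussianProd]
    exact Integrable.fintype_prod fun m : J => hφ m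
  refine (h.comp_measurable (Finset.measurable_restrict J)).congr (ae_of_all _ fun x => ?_)
  exact Finset.prod_coe_sort J fun m => φ m (x m)

theorem integral_prod_gaussianProd {J : Finset ℕ} {φ : ℕ → ℝ → ℝ}
    (hφ : ∀ m, Continuous (φ m)) :
    ∫ x, ∏ m ∈ J, φ m (x m) ∂gaussianProd = ∏ m ∈ J, ∫ t, φ m t ∂gaussianReal 0 1 := by
  have h := integral_map (μ := gaussianProd) (Finset.measurable_restrict J).aemeasurable
    (f := fun y : J → ℝ => ∏ m : J, φ m (y m))
    (by
      refine Continuous.aestronglyMeasurable ?_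
      exact continuous_finsetProd _ fun m _ => (hφ m).comp (continuous_apply m))
  rw [map_restrict_gaussianProd, integral_fintype_prod_eq_prod (fun m : J => φ m),
    Finset.prod_coe_sort J fun m => ∫ t, φ m t ∂gaussianReal 0 1] at h
  rw [h]
  refine integral_congr_ae (ae_of_all _ fun x => ?_)
  exact (Finset.prod_coe_sort J fun m => φ m (x m)).symm

theorem memLp_two_multiHermite (ν : MultiIndex) : MemLp (multiHermite ν) 2 gaussianProd := by
  refine (memLp_two_iff_integrable_sq (continuous_multiHermite ν).aestronglyMeasurable).2 ?_
  simp only [multiHermite, ← Finset.prod_pow]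
  exact integrable_prod_gaussianProd (φ := fun m t => hermiteFun (ν m) t ^ 2) fun m =>
    (memLp_two_hermiteFun (ν m)).integrable_sq

theorem integral_multiHermite_mul_multiHermite (ν κ : MultiIndex) :
    ∫ x, multiHermite ν x * multiHermite κ x ∂gaussianProd = if ν = κ then 1 else 0 := by
  have h : ∀ x, multiHermite ν x * multiHermite κ x = ∏ m ∈ ν.support ∪ κ.support,
      (fun m t => hermiteFun (ν m) t * hermiteFun (κ m) t) m (x m) := by
    intro x
    rw [multiHermite_eq_prod (Finset.subset_union_left (s₂ := κ.support)),
      multiHermite_eq_prod (Finset.subset_union_right (s₁ := ν.support)),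
      ← Finset.prod_mul_distrib]
  rw [integral_congr_ae (ae_of_all _ h), integral_prod_gaussianProd
    (φ := fun m t => hermiteFun (ν m) t * hermiteFun (κ m) t) fun m =>
      (continuous_hermiteFun _).mul (continuous_hermiteFun _)]
  simp_rw [integral_hermiteFun_mul_hermiteFun]
  split_ifs with hνκ
  · simp [hνκ]
  · obtain ⟨m, hm⟩ := DFunLike.ne_iff.1 hνκ
    refine Finset.prod_eq_zero (i := m) ?_ (if_neg hm)
    by_contra hmem
    simp only [Finset.mem_union, Finsupp.mem_support_iff, not_or, not_not] at hmem
    exact hm (hmem.1.trans hmem.2.symm)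

theorem eLpNorm_multiHermite (ν : MultiIndex) : eLpNorm (multiHermite ν) 2 gaussianProd = 1 := by
  have h := integral_multiHermite_mul_multiHermite ν ν
  rw [(memLp_two_multiHermite ν).eLpNorm_eq_integral_rpow_norm two_ne_zero ENNReal.ofNat_ne_top]
  have h2 : ∫ x, ‖multiHermite ν x‖ ^ (2 : ENNReal).toReal ∂gaussianProd = 1 := by
    rw [if_pos rfl] at h
    rw [← h]
    refine integral_congr_ae (ae_of_all _ fun x => ?_)
    simp [sq]
  rw [h2]
  simp

end Multivariate

/-! ### Polynomials in finitely many coordinates. -/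

section Span

/-- The space of polynomials in finitely many coordinates, spanned by the multivariate Hermite
polynomials. -/
noncomputable def hermiteSpan : Submodule ℝ ((ℕ → ℝ) → ℝ) :=
  Submodule.span ℝ (Set.range multiHermite)

theorem multiHermite_mem_hermiteSpan (ν : MultiIndex) : multiHermite ν ∈ hermiteSpan :=
  Submodule.subset_span ⟨ν, rfl⟩

theorem multiHermite_update (ν : MultiIndex) (m k : ℕ) (x : ℕ → ℝ) :
    multiHermite (ν.update m k) x =
      hermiteFun k (x m) * ∏ j ∈ ν.support.erase m, hermiteFun (ν j) (x j) := by
  classical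
  have hsub : (ν.update m k).support ⊆ insert m (ν.support.erase m) := by
    intro j hj
    by_cases hjm : j = m
    · simp [hjm]
    · simpa [hjm, Finsupp.update_apply] using hj
  rw [multiHermite_eq_prod hsub, Finset.prod_insert (Finset.notMem_erase m _)]
  congr 1
  · simp
  · refine Finset.prod_congr rfl fun j hj => ?_
    simp [Finsupp.update_apply, Finset.ne_of_mem_erase hj]

theorem coord_mul_mem_hermiteSpan (m : ℕ) {q : (ℕ → ℝ) → ℝ} (hq : q ∈ hermiteSpan) :
    (fun x => x m * q x) ∈ hermiteSpan := by
  induction hq using Submodule.span_induction with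
  | mem q hq =>
    obtain ⟨ν, rfl⟩ := hq
    obtain ⟨a, b, hab⟩ := exists_mul_hermiteFun (ν m)
    have h : (fun x : ℕ → ℝ => x m * multiHermite ν x) =
        a • multiHermite (ν.update m (ν m + 1)) + b • multiHermite (ν.update m (ν m - 1)) := by
      funext x
      -- Writing `ν` as its own update isolates the factor in coordinate `m`, to which the
      -- univariate recurrence applies.
      conv_lhs => rw [← ν.update_self m]
      simp only [Pi.add_apply, Pi.smul_apply, smul_eq_mul, multiHermite_update]
      rw [← mul_assoc, hab]
      ring
    rw [h]
    exact add_mem (Submodule.smul_mem _ _ (multiHermite_mem_hermiteSpan _))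
      (Submodule.smul_mem _ _ (multiHermite_mem_hermiteSpan _))
  | zero =>
    convert hermiteSpan.zero_mem using 2 with x
    simp
  | add q r _ _ hq hr => simpa [mul_add] using! add_mem hq hr
  | smul c q _ hq => simpa [mul_left_comm] using! Submodule.smul_mem _ c hq

/-- These powers are the terms of the exponential series of a characteristic function. -/
theorem linear_pow_mem_hermiteSpan (I : Finset ℕ) (t : ℕ → ℝ) (n : ℕ) :
    (fun x : ℕ → ℝ => (∑ m ∈ I, t m * x m) ^ n) ∈ hermiteSpan := by
  induction n with
  | zero =>
    convert multiHermite_mem_hermiteSpan 0 using 2 with x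
    simp [multiHermite_zero]
  | succ n ih =>
    have h : (fun x : ℕ → ℝ => (∑ m ∈ I, t m * x m) ^ (n + 1)) =
        ∑ m ∈ I, t m • fun x : ℕ → ℝ => x m * (∑ m ∈ I, t m * x m) ^ n := by
      funext x
      simp [pow_succ', Finset.sum_mul, mul_assoc]
    rw [h]
    exact sum_mem fun m _ => Submodule.smul_mem _ _ (coord_mul_mem_hermiteSpan m ih)

theorem memLp_two_of_mem_hermiteSpan {q : (ℕ → ℝ) → ℝ} (hq : q ∈ hermiteSpan) :
    MemLp q 2 gaussianProd := by
  induction hq using Submodule.span_induction with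
  | mem q hq =>
    obtain ⟨ν, rfl⟩ := hq
    exact memLp_two_multiHermite ν
  | zero => exact MemLp.zero
  | add q r _ _ hq hr => exact hq.add hr
  | smul c q _ hq => exact hq.const_smul c

theorem integral_mul_eq_zero_of_mem_hermiteSpan {g : (ℕ → ℝ) → ℝ} (hg : MemLp g 2 gaussianProd)
    (h0 : ∀ ν, ∫ x, multiHermite ν x * g x ∂gaussianProd = 0)
    {q : (ℕ → ℝ) → ℝ} (hq : q ∈ hermiteSpan) : ∫ x, q x * g x ∂gaussianProd = 0 := by
  induction hq using Submodule.span_induction with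
  | mem q hq =>
    obtain ⟨ν, rfl⟩ := hq
    exact h0 ν
  | zero => simp
  | add q r hqm hrm hq hr =>
    simp only [Pi.add_apply, add_mul]
    have h := integral_add ((memLp_two_of_mem_hermiteSpan hqm).integrable_mul hg)
      ((memLp_two_of_mem_hermiteSpan hrm).integrable_mul hg)
    simp only [Pi.mul_apply] at h
    rw [h, hq, hr, add_zero]
  | smul c q _ hq =>
    simp only [Pi.smul_apply, smul_eq_mul, mul_assoc]
    rw [integral_const_mul, hq, mul_zero]

end Span

/-! ### Completeness of the Hermite system. -/

section Complete

theorem integrable_exp_linear (I : Finset ℕ) (t : ℕ → ℝ) :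
    Integrable (fun x : ℕ → ℝ => Real.exp (∑ m ∈ I, t m * x m)) gaussianProd := by
  simp only [Real.exp_sum]
  exact integrable_prod_gaussianProd (φ := fun m s => Real.exp (t m * s)) fun m =>
    integrable_exp_mul_gaussianReal (t m)

/-- Supplies the majorant for termwise integration; it rests on `exp (2|s|) ≤ exp (2s) + exp (-2s)`.
-/
theorem memLp_two_exp_abs_linear (I : Finset ℕ) (t : ℕ → ℝ) :
    MemLp (fun x : ℕ → ℝ => Real.exp |∑ m ∈ I, t m * x m|) 2 gaussianProd := by
  have hc : Continuous fun x : ℕ → ℝ => ∑ m ∈ I, t m * x m := by fun_prop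
  have hce : Continuous fun x : ℕ → ℝ => Real.exp |∑ m ∈ I, t m * x m| :=
    Real.continuous_exp.comp hc.abs
  refine (memLp_two_iff_integrable_sq hce.aestronglyMeasurable).2 ?_
  refine ((integrable_exp_linear I fun m => 2 * t m).add
    (integrable_exp_linear I fun m => -2 * t m)).mono' (hce.pow 2).aestronglyMeasurable
    (ae_of_all _ fun x => ?_)
  have h1 : ∑ m ∈ I, 2 * t m * x m = 2 * ∑ m ∈ I, t m * x m := by
    simp [Finset.mul_sum, mul_assoc]
  have h2 : ∑ m ∈ I, -2 * t m * x m = -(2 * ∑ m ∈ I, t m * x m) := by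
    simp [Finset.mul_sum, mul_assoc]
  simp only [Pi.add_apply, h1, h2]
  rw [Real.norm_of_nonneg (by positivity), ← Real.exp_nat_mul]
  push_cast
  rcases abs_cases (∑ m ∈ I, t m * x m) with ⟨h, _⟩ | ⟨h, _⟩ <;> rw [h]
  · linarith [Real.exp_pos (-(2 * ∑ m ∈ I, t m * x m))]
  · rw [mul_neg]
    linarith [Real.exp_pos (2 * ∑ m ∈ I, t m * x m)]

/-- Every term of the exponential series integrates to zero against `g`. The partial sums are
dominated by `exp |s| * |g|`, a product of two `L²` functions. -/
theorem integral_mul_cexp_eq_zero {g : (ℕ → ℝ) → ℝ} (hg : MemLp g 2 gaussianProd)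
    (h0 : ∀ ν, ∫ x, multiHermite ν x * g x ∂gaussianProd = 0) (I : Finset ℕ) (t : ℕ → ℝ) :
    ∫ x, (g x : ℂ) * Complex.exp ((∑ m ∈ I, t m * x m : ℝ) * Complex.I) ∂gaussianProd = 0 := by
  have hc : Continuous fun x : ℕ → ℝ => ∑ m ∈ I, t m * x m := by fun_prop
  have key := hasSum_integral_of_dominated_convergence (μ := gaussianProd)
    (F := fun (n : ℕ) (x : ℕ → ℝ) => (Complex.I ^ n / (n.factorial : ℂ)) *
      (((∑ m ∈ I, t m * x m) ^ n * g x : ℝ) : ℂ))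
    (f := fun x => (g x : ℂ) * Complex.exp ((∑ m ∈ I, t m * x m : ℝ) * Complex.I))
    (fun n x => |∑ m ∈ I, t m * x m| ^ n / n.factorial * |g x|)
    (fun n => (Complex.continuous_ofReal.comp_aestronglyMeasurable
      ((hc.pow n).aestronglyMeasurable.mul hg.1)).const_mul _)
    (fun n => ae_of_all _ fun x => by
      apply le_of_eq
      simp only [norm_mul, norm_div, norm_pow, Complex.norm_I, one_pow, Complex.norm_natCast,
        Complex.norm_real, Real.norm_eq_abs]
      ring)
    (ae_of_all _ fun x => (Real.summable_pow_div_factorial _).mul_right _)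
    (by
      have h := (memLp_two_exp_abs_linear I t).integrable_mul hg.norm
      refine h.congr (ae_of_all _ fun x => ?_)
      simp only [Pi.mul_apply]
      rw [tsum_mul_right, Real.exp_eq_exp_ℝ, NormedSpace.exp_eq_tsum_div, Real.norm_eq_abs])
    (ae_of_all _ fun x => by
      have h := (NormedSpace.expSeries_div_hasSum_exp
        ((∑ m ∈ I, t m * x m : ℝ) * Complex.I)).mul_left (g x : ℂ)
      rw [← Complex.exp_eq_exp_ℂ] at h
      refine Eq.mp (congrArg (fun F => HasSum F _) (funext fun n => ?_)) h
      push_cast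
      rw [mul_pow]
      ring)
  refine key.unique ?_
  convert hasSum_zero with n
  rw [integral_const_mul, integral_complex_ofReal,
    integral_mul_eq_zero_of_mem_hermiteSpan hg h0 (linear_pow_mem_hermiteSpan I t n)]
  simp

theorem sum_coord_eq_dual (I : Finset ℕ) (L : StrongDual ℝ (I → ℝ)) :
    ∃ t : ℕ → ℝ, ∀ x : ℕ → ℝ, L (I.restrict x) = ∑ m ∈ I, t m * x m := by
  classical
  refine ⟨fun m => if h : m ∈ I then L (Pi.single ⟨m, h⟩ 1) else 0, fun x => ?_⟩
  rw [← Finset.sum_coe_sort I]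
  conv_lhs => rw [← Finset.univ_sum_single (I.restrict x), map_sum]
  refine Finset.sum_congr rfl fun m _ => ?_
  simp only [dif_pos m.2]
  have h : (Pi.single m (I.restrict x m) : I → ℝ) = x m • Pi.single m 1 := by
    rw [← Pi.single_smul]
    simp
  rw [h, map_smul, smul_eq_mul, mul_comm]

/-- The positive and negative parts of `g` are densities of finite measures whose finite-dimensional
marginals have equal characteristic functions. Uniqueness of projective limits identifies the
measures, hence the two parts almost everywhere. -/
theorem ae_eq_zero_of_integral_multiHermite_mul {g : (ℕ → ℝ) → ℝ} (hg : MemLp g 2 gaussianProd)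
    (h0 : ∀ ν, ∫ x, multiHermite ν x * g x ∂gaussianProd = 0) : g =ᵐ[gaussianProd] 0 := by
  have hgi : Integrable g gaussianProd := hg.integrable one_le_two
  have hmp : AEMeasurable (fun x => ENNReal.ofReal (g x)) gaussianProd :=
    hgi.1.aemeasurable.ennreal_ofReal
  have hmn : AEMeasurable (fun x => ENNReal.ofReal (-g x)) gaussianProd :=
    hgi.1.aemeasurable.neg.ennreal_ofReal
  have : IsFiniteMeasure (gaussianProd.withDensity fun x => ENNReal.ofReal (g x)) :=
    isFiniteMeasure_withDensity_ofReal hgi.2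
  have : IsFiniteMeasure (gaussianProd.withDensity fun x => ENNReal.ofReal (-g x)) :=
    isFiniteMeasure_withDensity_ofReal hgi.neg.2
  have hmarg : ∀ I : Finset ℕ,
      (gaussianProd.withDensity fun x => ENNReal.ofReal (g x)).map I.restrict =
        (gaussianProd.withDensity fun x => ENNReal.ofReal (-g x)).map I.restrict := by
    intro I
    refine Measure.ext_of_charFunDual (funext fun L => ?_)
    obtain ⟨t, ht⟩ := sum_coord_eq_dual I L
    have hcont : Continuous fun v : I → ℝ => Complex.exp (L v * Complex.I) := by fun_prop
    have hc : Continuous fun x : ℕ → ℝ =>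
        Complex.exp ((∑ m ∈ I, t m * x m : ℝ) * Complex.I) := by fun_prop
    have hint : ∀ g : (ℕ → ℝ) → ℝ, Integrable g gaussianProd → Integrable (fun x =>
        (ENNReal.ofReal (g x)).toReal • Complex.exp ((∑ m ∈ I, t m * x m : ℝ) * Complex.I))
          gaussianProd := by
      intro g hg
      refine hg.norm.mono' (hg.1.aemeasurable.ennreal_ofReal.ennreal_toReal.aestronglyMeasurable.smul
        hc.aestronglyMeasurable) (ae_of_all _ fun x => ?_)
      rw [norm_smul, Complex.norm_exp_ofReal_mul_I, mul_one, ENNReal.toReal_ofReal',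
        Real.norm_of_nonneg (le_max_right _ _)]
      exact max_le (Real.le_norm_self _) (norm_nonneg _)
    rw [charFunDual_apply, charFunDual_apply,
      integral_map (Finset.measurable_restrict I).aemeasurable hcont.aestronglyMeasurable,
      integral_map (Finset.measurable_restrict I).aemeasurable hcont.aestronglyMeasurable]
    simp only [ht]
    rw [integral_withDensity_eq_integral_toReal_smul₀ hmp (ae_of_all _ fun _ => by simp),
      integral_withDensity_eq_integral_toReal_smul₀ hmn (ae_of_all _ fun _ => by simp),
      ← sub_eq_zero, ← integral_sub]
    · rw [← integral_mul_cexp_eq_zero hg h0 I t]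
      refine integral_congr_ae (ae_of_all _ fun x => ?_)
      simp only [ENNReal.toReal_ofReal', Complex.real_smul]
      rw [← sub_mul, ← Complex.ofReal_sub, max_zero_sub_eq_self]
    · exact hint g hgi
    · exact hint (fun x => -g x) hgi.neg
  have heq := IsProjectiveLimit.unique (P := fun I =>
    (gaussianProd.withDensity fun x => ENNReal.ofReal (-g x)).map I.restrict)
    hmarg (fun _ => rfl)
  have hae := (withDensity_eq_iff_of_sigmaFinite hmp hmn).1 heq
  filter_upwards [hae] with x hx
  rcases le_total 0 (g x) with h | h
  · rw [ENNReal.ofReal_of_nonpos (neg_nonpos.2 h), ENNReal.ofReal_eq_zero] at hx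
    exact le_antisymm hx h
  · rw [ENNReal.ofReal_of_nonpos h, eq_comm, ENNReal.ofReal_eq_zero] at hx
    exact le_antisymm h (neg_nonpos.1 hx)

theorem ae_eq_zero_of_integral_multiHermite_smul {H : Type*} [NormedAddCommGroup H]
    [InnerProductSpace ℝ H] [CompleteSpace H] [TopologicalSpace.SeparableSpace H]
    {g : (ℕ → ℝ) → H} (hg : MemLp g 2 gaussianProd)
    (h0 : ∀ ν, ∫ x, multiHermite ν x • g x ∂gaussianProd = 0) : g =ᵐ[gaussianProd] 0 := by
  have : SecondCountableTopology H := UniformSpace.secondCountable_of_separable H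
  refine ae_eq_zero_of_forall_inner (𝕜 := ℝ) fun c => ?_
  refine ae_eq_zero_of_integral_multiHermite_mul (hg.const_inner c) fun ν => ?_
  have h := integral_inner (𝕜 := ℝ) (memLp_one_iff_integrable.1 (hg.smul (r := 1) (memLp_two_multiHermite ν))) c
  simp only [Pi.smul_apply', h0, inner_zero_right, inner_smul_right] at h
  exact h

end Complete

/-! ### Sums of products over boxes of multi-indices. -/

section Box

theorem sum_finsupp_prod {J : Finset ℕ} {t : ℕ → Finset ℕ} (F : ℕ → ℕ → ℝ) :
    ∑ k ∈ J.finsupp t, ∏ m ∈ J, F m (k m) = ∏ m ∈ J, ∑ j ∈ t m, F m j := by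
  rw [Finset.finsupp, Finset.sum_map, Finset.prod_sum]
  refine Finset.sum_congr (by congr!) fun p _ => ?_
  rw [← Finset.prod_attach]
  refine Finset.prod_congr rfl fun m _ => ?_
  simp

theorem Icc_eq_finsupp {a b : MultiIndex} {J : Finset ℕ} (hb : b.support ⊆ J) (hab : a ≤ b) :
    Finset.Icc a b = J.finsupp fun m => Finset.Icc (a m) (b m) := by
  ext k
  have hb0 : ∀ m, m ∉ J → b m = 0 := fun m hm => Finsupp.notMem_support_iff.1 fun h => hm (hb h)
  simp only [Finset.mem_Icc, Finset.mem_finsupp_iff]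
  constructor
  · rintro ⟨h1, h2⟩
    exact ⟨(Finsupp.support_mono h2).trans hb, fun m _ => ⟨h1 m, h2 m⟩⟩
  · rintro ⟨h1, h2⟩
    have hk0 : ∀ m, m ∉ J → k m = 0 := fun m hm =>
      Finsupp.notMem_support_iff.1 fun h => hm (h1 h)
    constructor <;> intro m <;> by_cases hm : m ∈ J
    · exact (h2 m hm).1
    · exact (hab m).trans ((hb0 m hm).trans_le (Nat.zero_le _))
    · exact (h2 m hm).2
    · exact (hk0 m hm).trans_le (Nat.zero_le _)

theorem sum_Icc_prod {a b : MultiIndex} {J : Finset ℕ} (hb : b.support ⊆ J) (hab : a ≤ b)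
    (F : ℕ → ℕ → ℝ) :
    ∑ k ∈ Finset.Icc a b, ∏ m ∈ J, F m (k m) =
      ∏ m ∈ J, ∑ j ∈ Finset.Icc (a m) (b m), F m j := by
  rw [Icc_eq_finsupp hb hab, sum_finsupp_prod]

theorem sum_Iic_prod {b : MultiIndex} {J : Finset ℕ} (hb : b.support ⊆ J)
    (F : ℕ → ℕ → ℝ) :
    ∑ k ∈ Finset.Iic b, ∏ m ∈ J, F m (k m) =
      ∏ m ∈ J, ∑ j ∈ Finset.range (b m + 1), F m j := by
  have h : Finset.Iic b = Finset.Icc 0 b := by ext k; simp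
  rw [h, sum_Icc_prod hb zero_le]
  refine Finset.prod_congr rfl fun m _ => Finset.sum_congr ?_ fun _ _ => rfl
  ext j
  simp

theorem prod_neg_one_pow {J : Finset ℕ} {i k : MultiIndex} (hi : i.support ⊆ J) :
    (-1 : ℝ) ^ (i - k).degree = ∏ m ∈ J, (-1 : ℝ) ^ (i m - k m) := by
  rw [Finset.prod_pow_eq_pow_sum, Finsupp.degree_apply,
    Finset.sum_subset ((Finsupp.support_tsub).trans hi)]
  · rfl
  · intro m _ hm
    exact Finsupp.notMem_support_iff.1 hm

end Box

/-! ### Univariate interpolation and its details. -/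

section Univariate

variable (ξ : ℕ → ℕ → ℝ)

/-- The univariate Lagrange interpolation operator `U_k`. -/
noncomputable def univInterp (k : ℕ) (φ : ℝ → ℝ) (t : ℝ) : ℝ :=
  ∑ j ∈ Finset.range (k + 1), (lagrangePoly ξ k j).eval t * φ (ξ k j)

/-- The univariate detail operator `U_i - U_{i - 1}`, where `U_{-1} = 0`. -/
noncomputable def univDetail (i : ℕ) (φ : ℝ → ℝ) (t : ℝ) : ℝ :=
  ∑ k ∈ Finset.Icc i.pred i, (-1 : ℝ) ^ (i - k) * univInterp ξ k φ t

variable {ξ}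

theorem univInterp_hermiteFun (hξ : ∀ k : ℕ, Set.InjOn (ξ k) (Set.Iic k)) {n k : ℕ} (h : n ≤ k)
    (t : ℝ) : univInterp ξ k (hermiteFun n) t = hermiteFun n t := by
  have hinj : Set.InjOn (ξ k) (Finset.range (k + 1)) := (hξ k).mono fun i hi => by
    simpa [Nat.lt_succ_iff] using hi
  have h := congrArg (Polynomial.eval t) (Lagrange.eq_interpolate hinj (f := hermitePoly n)
    (by simpa using degree_hermitePoly_lt h))
  rw [eval_hermitePoly, Lagrange.interpolate_apply, Polynomial.eval_finsetSum] at h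
  rw [h, univInterp]
  refine Finset.sum_congr rfl fun j _ => ?_
  simp [lagrangePoly, eval_hermitePoly, mul_comm]

/-- Since `Nat.pred 0 = 0`, the interval of levels is a single point, which encodes `U_{-1} = 0`. -/
theorem univDetail_zero (φ : ℝ → ℝ) (t : ℝ) : univDetail ξ 0 φ t = univInterp ξ 0 φ t := by
  simp [univDetail]

theorem univDetail_succ (i : ℕ) (φ : ℝ → ℝ) (t : ℝ) :
    univDetail ξ (i + 1) φ t = univInterp ξ (i + 1) φ t - univInterp ξ i φ t := by
  rw [univDetail, Nat.pred_succ, Finset.sum_Icc_succ_top (Nat.le_succ i)]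
  simp
  ring

theorem univDetail_hermiteFun_of_lt (hξ : ∀ k : ℕ, Set.InjOn (ξ k) (Set.Iic k)) {n i : ℕ}
    (h : n < i) (t : ℝ) : univDetail ξ i (hermiteFun n) t = 0 := by
  obtain ⟨j, rfl⟩ := Nat.exists_eq_succ_of_ne_zero (Nat.ne_zero_of_lt h)
  rw [Nat.succ_eq_add_one, univDetail_succ, univInterp_hermiteFun hξ h.le,
    univInterp_hermiteFun hξ (Nat.lt_succ_iff.1 h), sub_self]

theorem sum_univDetail (n : ℕ) (φ : ℝ → ℝ) (t : ℝ) :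
    ∑ i ∈ Finset.range (n + 1), univDetail ξ i φ t = univInterp ξ n φ t := by
  induction n with
  | zero => simp [univDetail_zero]
  | succ n ih => rw [Finset.sum_range_succ, ih, univDetail_succ]; ring

end Univariate

/-! ### Tensorized operators on Hermite polynomials. -/

section Tensor

variable {ξ : ℕ → ℕ → ℝ}

theorem tensorLagrange_eq_prod {k i : MultiIndex} (hik : i ≤ k) {J : Finset ℕ}
    (hk : k.support ⊆ J) (x : ℕ → ℝ) :
    tensorLagrange ξ k i x = ∏ m ∈ J, (lagrangePoly ξ (k m) (i m)).eval (x m) := by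
  refine Finset.prod_subset hk fun m _ hm => ?_
  have h := Finsupp.notMem_support_iff.1 hm
  have h' : i m = 0 := Nat.le_zero.1 ((hik m).trans_eq h)
  -- At level zero the only fundamental polynomial is an empty product.
  rw [h, h', lagrangePoly]
  simp

theorem tensorInterp_multiHermite {k ν : MultiIndex} {J : Finset ℕ} (hk : k.support ⊆ J)
    (hν : ν.support ⊆ J) (x : ℕ → ℝ) :
    tensorInterp ξ k (multiHermite ν) x =
      ∏ m ∈ J, univInterp ξ (k m) (hermiteFun (ν m)) (x m) := by
  simp only [univInterp]
  rw [← sum_Iic_prod hk, tensorInterp]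
  refine Finset.sum_congr rfl fun i hi => ?_
  rw [tensorLagrange_eq_prod (Finset.mem_Iic.1 hi) hk, multiHermite_eq_prod hν, smul_eq_mul,
    ← Finset.prod_mul_distrib]
  rfl

/-- Both the sign and the box of levels factor over coordinates, so the expanded operator acts as a
tensor product. -/
theorem detailOp_multiHermite {i ν : MultiIndex} {J : Finset ℕ} (hi : i.support ⊆ J)
    (hν : ν.support ⊆ J) (x : ℕ → ℝ) :
    detailOp ξ i (multiHermite ν) x =
      ∏ m ∈ J, univDetail ξ (i m) (hermiteFun (ν m)) (x m) := by
  have hle : i.mapRange Nat.pred rfl ≤ i := fun m => by simp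
  have h := sum_Icc_prod hi hle fun m j =>
    (-1 : ℝ) ^ (i m - j) * univInterp ξ j (hermiteFun (ν m)) (x m)
  simp only [Finsupp.mapRange_apply] at h
  simp only [univDetail]
  rw [← h, detailOp]
  refine Finset.sum_congr rfl fun k hk => ?_
  rw [tensorInterp_multiHermite ((Finsupp.support_mono (Finset.mem_Icc.1 hk).2).trans hi) hν,
    prod_neg_one_pow hi, smul_eq_mul, ← Finset.prod_mul_distrib]

theorem detailOp_multiHermite_eq_zero (hξ : ∀ k : ℕ, Set.InjOn (ξ k) (Set.Iic k))
    {i ν : MultiIndex} (h : ¬ i ≤ ν) (x : ℕ → ℝ) : detailOp ξ i (multiHermite ν) x = 0 := by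
  obtain ⟨m, hm⟩ : ∃ m, ν m < i m := by
    by_contra! hle
    exact h hle
  rw [detailOp_multiHermite (Finset.subset_union_left (s₂ := ν.support))
    (Finset.subset_union_right (s₁ := i.support))]
  refine Finset.prod_eq_zero (i := m) (Finset.mem_union_left _ ?_)
    (univDetail_hermiteFun_of_lt hξ hm _)
  exact Finsupp.mem_support_iff.2 (Nat.ne_zero_of_lt hm)

/-- Sparse collocation on a monotone set reproduces the Hermite polynomials of that set. -/
theorem sparseColloc_multiHermite (hξ : ∀ k : ℕ, Set.InjOn (ξ k) (Set.Iic k))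
    {Λ : Finset MultiIndex} (hΛ : IsLowerSet (Λ : Set MultiIndex)) {ν : MultiIndex} (hν : ν ∈ Λ)
    (x : ℕ → ℝ) : sparseColloc ξ Λ (multiHermite ν) x = multiHermite ν x := by
  -- Monotonicity of `Λ` puts every detail that does not annihilate `H_ν` into the sum; the sum over
  -- this box factorizes and telescopes.
  have hsub : Finset.Iic ν ⊆ Λ := fun i hi => hΛ (Finset.mem_Iic.1 hi) hν
  rw [sparseColloc, ← Finset.sum_subset hsub fun i _ hi =>
    detailOp_multiHermite_eq_zero hξ (fun h => hi (Finset.mem_Iic.2 h)) x]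
  have h : ∀ i ∈ Finset.Iic ν, detailOp ξ i (multiHermite ν) x =
      ∏ m ∈ ν.support, univDetail ξ (i m) (hermiteFun (ν m)) (x m) := fun i hi =>
    detailOp_multiHermite (Finsupp.support_mono (Finset.mem_Iic.1 hi)) subset_rfl x
  rw [Finset.sum_congr rfl h,
    sum_Iic_prod subset_rfl fun m j => univDetail ξ j (hermiteFun (ν m)) (x m)]
  refine Finset.prod_congr rfl fun m _ => ?_
  rw [sum_univDetail, univInterp_hermiteFun hξ le_rfl]

end Tensor

/-- Stechkin's inequality: the tail of a `p`-summable family outside of a set of its `N` largest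
terms. -/
theorem tsum_indicator_compl_le_stechkin {ι : Type*} {a : ι → ℝ} (ha : ∀ i, 0 ≤ a i) {p : ℝ}
    (hp0 : 0 < p) (hp1 : p < 1) (hsum : Summable fun i => a i ^ p) {s : Finset ι}
    (hs : ∀ i ∈ s, ∀ j ∉ s, a j ≤ a i) :
    ∑' i, (s : Set ι)ᶜ.indicator (fun i => ENNReal.ofReal (a i)) i ≤
      ENNReal.ofReal ((∑' i, a i ^ p) ^ (1 / p) * ((s.card : ℝ) + 1) ^ (-(1 / p - 1))) := by
  classical
  set S := ∑' i, a i ^ p with hS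
  have hS0 : 0 ≤ S := tsum_nonneg fun i => Real.rpow_nonneg (ha i) p
  have hN : (0 : ℝ) < (s.card : ℝ) + 1 := by positivity
  have hq : 0 < 1 / p - 1 := by
    rw [sub_pos, lt_div_iff₀ hp0]
    linarith
  have hterm : ∀ j ∉ s, a j ≤ a j ^ p * (S / ((s.card : ℝ) + 1)) ^ (1 / p - 1) := by
    intro j hj
    -- Counting `j` together with `s` gives `s.card + 1` terms of size at least `a j ^ p`, so empty
    -- `s` is covered too.
    have h1 : ((s.card : ℝ) + 1) * a j ^ p ≤ S := by
      have h2 : ∑ i ∈ insert j s, a j ^ p ≤ ∑ i ∈ insert j s, a i ^ p := by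
        refine Finset.sum_le_sum fun i hi => Real.rpow_le_rpow (ha j) ?_ hp0.le
        rcases Finset.mem_insert.1 hi with rfl | hi
        · exact le_rfl
        · exact hs i hi j hj
      rw [Finset.sum_const, Finset.card_insert_of_notMem hj, nsmul_eq_mul] at h2
      push_cast at h2
      exact h2.trans (hsum.sum_le_tsum _ fun i _ => Real.rpow_nonneg (ha i) p)
    have h3 : a j ^ p ≤ S / ((s.card : ℝ) + 1) := by
      rw [le_div_iff₀ hN]
      linarith
    calc a j = (a j ^ p) ^ (1 + (1 / p - 1)) := by
          rw [add_sub_cancel, ← Real.rpow_mul (ha j), mul_one_div_cancel hp0.ne', Real.rpow_one]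
      _ = a j ^ p * (a j ^ p) ^ (1 / p - 1) := by
          rw [Real.rpow_add_of_nonneg (Real.rpow_nonneg (ha j) p) zero_le_one hq.le, Real.rpow_one]
      _ ≤ _ := by
          have := Real.rpow_nonneg (ha j) p
          gcongr
  calc ∑' i, (s : Set ι)ᶜ.indicator (fun i => ENNReal.ofReal (a i)) i
      ≤ ∑' i, ENNReal.ofReal (a i ^ p) *
          ENNReal.ofReal ((S / ((s.card : ℝ) + 1)) ^ (1 / p - 1)) := by
        refine ENNReal.tsum_le_tsum fun i => ?_
        by_cases hi : i ∈ s
        · simp [hi]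
        · rw [Set.indicator_of_mem (by simpa using hi),
            ← ENNReal.ofReal_mul (Real.rpow_nonneg (ha i) p)]
          exact ENNReal.ofReal_le_ofReal (hterm i hi)
    _ = ENNReal.ofReal (S ^ (1 / p) * ((s.card : ℝ) + 1) ^ (-(1 / p - 1))) := by
        rw [ENNReal.tsum_mul_right,
          ← ENNReal.ofReal_tsum_of_nonneg (fun i => Real.rpow_nonneg (ha i) p) hsum,
          ← ENNReal.ofReal_mul hS0]
        congr 1
        rw [Real.div_rpow hS0 hN.le, Real.rpow_neg hN.le, ← mul_div_assoc, div_eq_mul_inv]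
        congr 1
        conv_rhs => rw [← add_sub_cancel 1 (1 / p)]
        rw [Real.rpow_add_of_nonneg hS0 zero_le_one hq.le, Real.rpow_one]

/-! ### Monotone sets of largest terms. -/

section Greedy

variable {a : MultiIndex → ℝ}

/-- Among the maximizers of `a` off `Λ`, take a minimal one: an index strictly below it and off `Λ`
would be a maximizer as well, since `a` is nonincreasing. -/
theorem exists_maximal_extension (hanti : Antitone a) (ha : ∀ ν, 0 ≤ a ν)
    (hfin : ∀ ε > 0, {ν | ε ≤ a ν}.Finite) {Λ : Finset MultiIndex}
    (hΛ : IsLowerSet (Λ : Set MultiIndex)) :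
    ∃ ν ∉ Λ, IsLowerSet (insert ν Λ : Set MultiIndex) ∧ ∀ μ ∉ Λ, a μ ≤ a ν := by
  obtain ⟨ν₀, hν₀, hmax⟩ : ∃ ν ∉ Λ, ∀ μ ∉ Λ, a μ ≤ a ν := by
    obtain ⟨κ, hκ⟩ := Infinite.exists_notMem_finset Λ
    by_cases h : ∃ κ ∉ Λ, 0 < a κ
    · obtain ⟨κ, hκ, hpos⟩ := h
      obtain ⟨ν, ⟨hν, hνΛ⟩, hm⟩ := Set.exists_max_image ({ν | a κ ≤ a ν} ∩ {ν | ν ∉ Λ}) a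
        ((hfin _ hpos).subset Set.inter_subset_left) ⟨κ, le_refl (a κ), hκ⟩
      refine ⟨ν, hνΛ, fun μ hμ => ?_⟩
      rcases le_total (a κ) (a μ) with h | h
      · exact hm μ ⟨h, hμ⟩
      · exact h.trans hν
    -- If no value off `Λ` is positive, any index off `Λ` is a maximizer.
    · push Not at h
      exact ⟨κ, hκ, fun μ hμ => (h μ hμ).trans (ha κ)⟩
  obtain ⟨ν, ⟨hνΛ, hν⟩, hmin⟩ := WellFounded.has_min
    (wellFounded_lt (α := MultiIndex)) {ν | ν ∉ Λ ∧ ∀ μ ∉ Λ, a μ ≤ a ν} ⟨ν₀, hν₀, hmax⟩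
  refine ⟨ν, hνΛ, ?_, hν⟩
  rintro κ μ hμκ (rfl | hκ)
  · rcases hμκ.eq_or_lt with rfl | hlt
    · exact Set.mem_insert _ _
    · refine Set.mem_insert_of_mem _ ?_
      by_contra hμ
      exact hmin μ ⟨hμ, fun τ hτ => (hν τ hτ).trans (hanti hlt.le)⟩ hlt
  · exact Set.mem_insert_of_mem _ (hΛ hμκ hκ)

/-- A nested sequence of finite monotone sets of indices of largest terms. -/
theorem exists_nested_largest (hanti : Antitone a) (ha : ∀ ν, 0 ≤ a ν)
    (hfin : ∀ ε > 0, {ν | ε ≤ a ν}.Finite) :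
    ∃ Λ : ℕ → Finset MultiIndex, Monotone Λ ∧ (∀ N, IsLowerSet (Λ N : Set MultiIndex)) ∧
      (∀ N, (Λ N).card = N) ∧ ∀ N, ∀ ν ∈ Λ N, ∀ μ ∉ Λ N, a μ ≤ a ν := by
  classical
  choose next hnext using fun Λ : {Λ : Finset MultiIndex // IsLowerSet (Λ : Set MultiIndex)} =>
    exists_maximal_extension hanti ha hfin Λ.2
  let step : {Λ : Finset MultiIndex // IsLowerSet (Λ : Set MultiIndex)} →
      {Λ : Finset MultiIndex // IsLowerSet (Λ : Set MultiIndex)} := fun Λ =>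
    ⟨insert (next Λ) Λ.1, by simpa using (hnext Λ).2.1⟩
  let Λ : ℕ → {Λ : Finset MultiIndex // IsLowerSet (Λ : Set MultiIndex)} := fun N =>
    step^[N] ⟨∅, by simpa using isLowerSet_empty⟩
  have hsucc : ∀ N, (Λ (N + 1)).1 = insert (next (Λ N)) (Λ N).1 := fun N => by
    simp only [Λ, Function.iterate_succ_apply']
    rfl
  refine ⟨fun N => (Λ N).1, ?_, fun N => (Λ N).2, ?_, ?_⟩
  · refine monotone_nat_of_le_succ fun N => ?_
    rw [hsucc]
    exact Finset.subset_insert _ _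
  · intro N
    induction N with
    | zero => rfl
    | succ N ih =>
      beta_reduce at ih ⊢
      rw [hsucc, Finset.card_insert_of_notMem (hnext (Λ N)).1, ih]
  · intro N
    induction N with
    | zero => intro ν hν; exact absurd hν (Finset.notMem_empty ν)
    | succ N ih =>
      simp only [hsucc]
      intro ν hν μ hμ
      have hμ' : μ ∉ (Λ N).1 := fun h => hμ (Finset.mem_insert_of_mem h)
      rcases Finset.mem_insert.1 hν with rfl | hν
      · exact (hnext (Λ N)).2.2 μ hμ'
      · exact ih ν hν μ hμ'

theorem finite_setOf_le_of_summable_rpow {p : ℝ} (hp : 0 < p)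
    (hsum : Summable fun ν => |a ν| ^ p) {ε : ℝ} (hε : 0 < ε) : {ν | ε ≤ |a ν|}.Finite := by
  have h := hsum.tendsto_cofinite_zero.eventually_lt_const (Real.rpow_pos_of_pos hε p)
  refine (Filter.eventually_cofinite.1 h).subset fun ν hν => ?_
  exact not_lt.2 (Real.rpow_le_rpow hε.le hν hp.le)

/-- A negative value would persist, with at least the same modulus, at the infinitely many larger
indices, contradicting summability. -/
theorem nonneg_of_antitone_of_summable_rpow (hanti : Antitone a) {p : ℝ} (hp : 0 < p)
    (hsum : Summable fun ν => |a ν| ^ p) (ν : MultiIndex) : 0 ≤ a ν := by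
  by_contra! hν
  refine Set.Infinite.mono (s := Set.Ici ν) (fun μ hμ => ?_) ?_
    (finite_setOf_le_of_summable_rpow hp hsum (abs_pos.2 hν.ne))
  · have := hanti (Set.mem_Ici.1 hμ)
    rw [Set.mem_ofPred_eq, abs_of_neg hν, abs_of_neg (this.trans_lt hν)]
    linarith
  · refine Set.infinite_of_injective_forall_mem (f := fun n : ℕ => ν + Finsupp.single 0 n)
      (fun m n h => ?_) fun n => Set.mem_Ici.2 le_self_add
    exact Finsupp.single_injective 0 (add_left_cancel h)

end Greedy

/-! ### Norms of pointwise convergent series. -/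

section Series

open Filter Topology

/-- Fatou's lemma along a sequence exhausting the finite subsets, with Minkowski's inequality for
the partial sums. -/
theorem eLpNorm_le_tsum_eLpNorm {α ι E : Type*} {mα : MeasurableSpace α} {μ : Measure α}
    [NormedAddCommGroup E] [Countable ι] {p : ENNReal} (hp : 1 ≤ p) {F : ι → α → E} {f : α → E}
    (hF : ∀ i, AEStronglyMeasurable (F i) μ) (h : ∀ᵐ x ∂μ, HasSum (fun i => F i x) (f x)) :
    eLpNorm f p μ ≤ ∑' i, eLpNorm (F i) p μ := by
  obtain ⟨s, hs⟩ := exists_seq_tendsto (atTop : Filter (Finset ι))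
  have hlim : ∀ᵐ x ∂μ, Tendsto (fun n => (∑ i ∈ s n, F i) x) atTop (𝓝 (f x)) := by
    filter_upwards [h] with x hx
    simpa using! Tendsto.comp hx hs
  refine (Lp.eLpNorm_lim_le_liminf_eLpNorm
    (fun n => Finset.aestronglyMeasurable_sum (s n) fun i _ => hF i) f hlim).trans ?_
  refine (liminf_le_liminf (v := fun _ => ∑' i, eLpNorm (F i) p μ)
    (Eventually.of_forall fun n => ?_)).trans_eq (liminf_const _)
  exact (eLpNorm_sum_le (fun i _ => hF i) hp).trans (ENNReal.sum_le_tsum _)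

theorem aestronglyMeasurable_of_hasSum {α ι E : Type*} {mα : MeasurableSpace α} {μ : Measure α}
    [NormedAddCommGroup E] [Countable ι] {F : ι → α → E} {f : α → E}
    (hF : ∀ i, AEStronglyMeasurable (F i) μ) (h : ∀ᵐ x ∂μ, HasSum (fun i => F i x) (f x)) :
    AEStronglyMeasurable f μ := by
  refine aestronglyMeasurable_of_tendsto_ae (atTop : Filter (Finset ι))
    (f := fun s => ∑ i ∈ s, F i) (fun s => Finset.aestronglyMeasurable_sum s fun i _ => hF i) ?_
  filter_upwards [h] with x hx
  simpa using! hx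

theorem eLpNorm_smul_const {α E : Type*} {mα : MeasurableSpace α} {μ : Measure α}
    [NormedAddCommGroup E] [NormedSpace ℝ E] (q : α → ℝ) (c : E) (p : ENNReal) :
    eLpNorm (fun x => q x • c) p μ = eLpNorm q p μ * ‖c‖ₑ := by
  have h : eLpNorm (fun x => q x • c) p μ = eLpNorm (‖c‖ • q) p μ := by
    refine eLpNorm_congr_norm_ae (ae_of_all _ fun x => ?_)
    simp [norm_smul, mul_comm]
  rw [h, eLpNorm_const_smul, enorm_norm, mul_comm]

end Series

/-! ### Almost everywhere convergence of the Hermite series. -/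

section Expansion

variable {H : Type*} [NormedAddCommGroup H] [InnerProductSpace ℝ H] [CompleteSpace H]

theorem ae_summable_multiHermite_smul {c : MultiIndex → H} (hc : ∑' ν, ‖c ν‖ₑ ≠ ⊤) :
    ∀ᵐ x ∂gaussianProd, Summable fun ν => multiHermite ν x • c ν := by
  have hmeas : ∀ ν, AEMeasurable (fun x => ‖multiHermite ν x • c ν‖ₑ) gaussianProd := fun ν =>
    ((continuous_multiHermite ν).smul continuous_const).aestronglyMeasurable.enorm
  have hint : ∫⁻ x, ∑' ν, ‖multiHermite ν x • c ν‖ₑ ∂gaussianProd ≠ ⊤ := by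
    rw [lintegral_tsum hmeas]
    refine ne_top_of_le_ne_top hc (ENNReal.tsum_le_tsum fun ν => ?_)
    have h1 := eLpNorm_smul_const (μ := gaussianProd) (multiHermite ν) (c ν) 1
    rw [eLpNorm_one_eq_lintegral_enorm] at h1
    rw [h1]
    exact mul_le_of_le_one_left' ((eLpNorm_le_eLpNorm_of_exponent_le one_le_two
      (continuous_multiHermite ν).aestronglyMeasurable).trans_eq (eLpNorm_multiHermite ν))
  filter_upwards [ae_lt_top' (AEMeasurable.tsum hmeas) hint] with x hx
  exact Summable.of_enorm hx.ne

theorem integral_norm_multiHermite_mul_le (κ ν : MultiIndex) :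
    ∫ x, ‖multiHermite κ x * multiHermite ν x‖ ∂gaussianProd ≤ 1 := by
  have h1 := (memLp_two_multiHermite κ).integrable_sq
  have h2 := (memLp_two_multiHermite ν).integrable_sq
  have hκ := integral_multiHermite_mul_multiHermite κ κ
  have hν := integral_multiHermite_mul_multiHermite ν ν
  simp only [↓reduceIte, ← sq] at hκ hν
  calc ∫ x, ‖multiHermite κ x * multiHermite ν x‖ ∂gaussianProd
      ≤ ∫ x, (multiHermite κ x ^ 2 + multiHermite ν x ^ 2) / 2 ∂gaussianProd := by
        refine integral_mono_of_nonneg (ae_of_all _ fun x => norm_nonneg _)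
          ((h1.add h2).div_const 2) (ae_of_all _ fun x => ?_)
        simp only [Real.norm_eq_abs, abs_mul]
        nlinarith [sq_nonneg (|multiHermite κ x| - |multiHermite ν x|),
          sq_abs (multiHermite κ x), sq_abs (multiHermite ν x)]
    _ = 1 := by
        rw [integral_div, integral_add h1 h2, hκ, hν]
        norm_num

theorem integral_multiHermite_smul_tsum {c : MultiIndex → H} (hc : Summable fun ν => ‖c ν‖)
    (κ : MultiIndex) :
    ∫ x, multiHermite κ x • ∑' ν, multiHermite ν x • c ν ∂gaussianProd = c κ := by
  have hint : ∀ ν, Integrable (fun x => (multiHermite κ x * multiHermite ν x) • c ν)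
      gaussianProd := fun ν =>
    ((memLp_two_multiHermite κ).integrable_mul (memLp_two_multiHermite ν)).smul_const (c ν)
  have hnorm : ∀ ν, ∫ x, ‖(multiHermite κ x * multiHermite ν x) • c ν‖ ∂gaussianProd ≤ ‖c ν‖ := by
    intro ν
    simp only [norm_smul (_ * _)]
    rw [integral_mul_const]
    exact mul_le_of_le_one_left (norm_nonneg _) (integral_norm_multiHermite_mul_le κ ν)
  have key := hasSum_integral_of_summable_integral_norm hint
    (hc.of_nonneg_of_le (fun ν => integral_nonneg fun x => norm_nonneg _) hnorm)
  simp only [integral_smul_const, integral_multiHermite_mul_multiHermite] at key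
  simp only [mul_smul, tsum_const_smul''] at key
  refine key.unique ?_
  convert hasSum_ite_eq κ (c κ) using 2 with ν
  by_cases h : κ = ν
  · simp [h]
  · simp [h, Ne.symm h]

/-- A square integrable function with absolutely summable Hermite coefficients is almost everywhere
the sum of its Hermite series. -/
theorem ae_hasSum_hermite [TopologicalSpace.SeparableSpace H] {g : (ℕ → ℝ) → H}
    (hg : MemLp g 2 gaussianProd) {c : MultiIndex → H}
    (hgc : ∀ ν, ∫ x, multiHermite ν x • g x ∂gaussianProd = c ν) (hc : ∑' ν, ‖c ν‖ₑ ≠ ⊤) :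
    ∀ᵐ x ∂gaussianProd, HasSum (fun ν => multiHermite ν x • c ν) (g x) := by
  have hsum : ∀ᵐ x ∂gaussianProd, HasSum (fun ν => multiHermite ν x • c ν)
      (∑' ν, multiHermite ν x • c ν) := by
    filter_upwards [ae_summable_multiHermite_smul hc] with x hx using hx.hasSum
  have hmeas : ∀ ν, AEStronglyMeasurable (fun x => multiHermite ν x • c ν) gaussianProd := fun ν =>
    ((continuous_multiHermite ν).smul continuous_const).aestronglyMeasurable
  have hF : MemLp (fun x => ∑' ν, multiHermite ν x • c ν) 2 gaussianProd := by
    refine ⟨aestronglyMeasurable_of_hasSum hmeas hsum,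
      (eLpNorm_le_tsum_eLpNorm one_le_two hmeas hsum).trans_lt ?_⟩
    simp only [eLpNorm_smul_const, eLpNorm_multiHermite, one_mul]
    exact hc.lt_top
  have hcs : Summable fun ν => ‖c ν‖ := by
    simpa using ENNReal.summable_toReal hc
  -- `g` and the sum of the series have the same Hermite coefficients, so completeness makes them
  -- agree.
  have hzero := ae_eq_zero_of_integral_multiHermite_smul (hg.sub hF) fun κ => by
    have hint : ∀ {g : (ℕ → ℝ) → H}, MemLp g 2 gaussianProd →
        Integrable (fun x => multiHermite κ x • g x) gaussianProd := fun hg =>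
      memLp_one_iff_integrable.1 (hg.smul (memLp_two_multiHermite κ))
    simp only [Pi.sub_apply, smul_sub]
    rw [integral_sub (hint hg) (hint hF), hgc, integral_multiHermite_smul_tsum hcs, sub_self]
  filter_upwards [hsum, hzero] with x hx h0
  rwa [sub_eq_zero.1 h0]

end Expansion

/-! ### Termwise collocation and the error bound. -/

section Collocation

variable {H : Type*} [NormedAddCommGroup H] [NormedSpace ℝ H] {ξ : ℕ → ℕ → ℝ}

theorem gridPoint_mem_tensorGrid {k i : MultiIndex} (h : i ≤ k) :
    gridPoint ξ k i ∈ tensorGrid ξ k := fun m => ⟨i m, h m, rfl⟩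

theorem continuous_tensorLagrange (k i : MultiIndex) : Continuous (tensorLagrange ξ k i) :=
  continuous_finsetProd _ fun m _ => (Polynomial.continuous _).comp (continuous_apply m)

theorem continuous_sparseColloc (Λ : Finset MultiIndex) (g : (ℕ → ℝ) → H) :
    Continuous (sparseColloc ξ Λ g) :=
  continuous_finsetSum _ fun _ _ => continuous_finsetSum _ fun _ _ =>
    (continuous_finsetSum _ fun _ _ =>
      (continuous_tensorLagrange _ _).smul continuous_const).const_smul _

/-- Sparse collocation may be applied termwise to a series that converges at the grid nodes. -/
theorem hasSum_sparseColloc {ι : Type*} {q : ι → (ℕ → ℝ) → ℝ} {c : ι → H} {g : (ℕ → ℝ) → H}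
    (h : ∀ k : MultiIndex, ∀ y ∈ tensorGrid ξ k, HasSum (fun ν => q ν y • c ν) (g y))
    (Λ : Finset MultiIndex) (x : ℕ → ℝ) :
    HasSum (fun ν => sparseColloc ξ Λ (q ν) x • c ν) (sparseColloc ξ Λ g x) := by
  simp only [sparseColloc, detailOp, tensorInterp, Finset.sum_smul, smul_assoc]
  exact hasSum_sum fun i _ => hasSum_sum fun k _ => HasSum.const_smul _ <|
    hasSum_sum fun j hj => HasSum.const_smul _ <|
      h k _ (gridPoint_mem_tensorGrid (Finset.mem_Iic.1 hj))

theorem one_le_worstError (ν : MultiIndex) : 1 ≤ worstError ξ ν := by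
  refine le_iSup_of_le ∅ ?_
  simp [sparseColloc, eLpNorm_multiHermite]

/-- The error of sparse collocation on a monotone set is bounded by the sum over the complement. -/
theorem eLpNorm_sub_sparseColloc_le (hξ : ∀ k : ℕ, Set.InjOn (ξ k) (Set.Iic k))
    {g : (ℕ → ℝ) → H} {c : MultiIndex → H}
    (hae : ∀ᵐ x ∂gaussianProd, HasSum (fun ν => multiHermite ν x • c ν) (g x))
    (hgrid : ∀ k : MultiIndex, ∀ y ∈ tensorGrid ξ k,
      HasSum (fun ν => multiHermite ν y • c ν) (g y))
    {Λ : Finset MultiIndex} (hΛ : IsLowerSet (Λ : Set MultiIndex)) :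
    eLpNorm (fun x => g x - sparseColloc ξ Λ g x) 2 gaussianProd ≤
      ∑' ν, (Λ : Set MultiIndex)ᶜ.indicator (fun ν => worstError ξ ν * ‖c ν‖ₑ) ν := by
  have hsum : ∀ᵐ x ∂gaussianProd, HasSum
      (fun ν => (multiHermite ν x - sparseColloc ξ Λ (multiHermite ν) x) • c ν)
      (g x - sparseColloc ξ Λ g x) := by
    filter_upwards [hae] with x hx
    simpa only [sub_smul] using hx.sub (hasSum_sparseColloc hgrid Λ x)
  refine (eLpNorm_le_tsum_eLpNorm one_le_two
    (F := fun ν x => (multiHermite ν x - sparseColloc ξ Λ (multiHermite ν) x) • c ν) (fun ν => (((continuous_multiHermite ν).sub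
    (continuous_sparseColloc Λ _)).smul continuous_const).aestronglyMeasurable) hsum).trans ?_
  refine ENNReal.tsum_le_tsum fun ν => ?_
  rw [eLpNorm_smul_const]
  -- Exactness removes the terms with index in `Λ`; the others are controlled by the worst-case
  -- error.
  by_cases hν : ν ∈ Λ
  · simp [sparseColloc_multiHermite hξ hΛ hν]
  · rw [Set.indicator_of_mem (by simpa using hν)]
    gcongr
    exact le_iSup (fun Λ : Finset MultiIndex => eLpNorm (fun x => multiHermite ν x -
      sparseColloc ξ Λ (multiHermite ν) x) 2 gaussianProd) Λ

end Collocation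

end SparseCollocation

/-! ### The convergence rate. -/

theorem mainTheorem6
    {H : Type*} [NormedAddCommGroup H] [InnerProductSpace ℝ H] [CompleteSpace H]
    [TopologicalSpace.SeparableSpace H]
    -- the domain and the function, square integrable
    (Γ : Set (ℕ → ℝ)) (hΓ : ∀ᵐ x ∂gaussianProd, x ∈ Γ)
    (f : Γ → H) (hf : MemLp (extendZero f) 2 gaussianProd)
    -- distinct univariate nodes, with all product grids contained in the domain
    (ξ : ℕ → ℕ → ℝ) (hξ : ∀ k : ℕ, Set.InjOn (ξ k) (Set.Iic k))
    (hgrid : ∀ k : MultiIndex, tensorGrid ξ k ⊆ Γ)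
    -- the Hermite expansion of the function represents its point values at the grid nodes
    (hexp : ∀ k : MultiIndex, ∀ x : Γ, (x : ℕ → ℝ) ∈ tensorGrid ξ k →
      HasSum (fun ν : MultiIndex => multiHermite ν (x : ℕ → ℝ) • hermiteCoeff f ν) (f x))
    -- the nonincreasing `p`-summable majorant
    (p : ℝ) (hp0 : 0 < p) (hp1 : p < 1)
    (chat : MultiIndex → ℝ) (hanti : Antitone chat)
    (hsum : Summable fun ν : MultiIndex => |chat ν| ^ p)
    (hbound : ∀ ν : MultiIndex,
      worstError ξ ν * ‖hermiteCoeff f ν‖ₑ ≤ ENNReal.ofReal (chat ν)) :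
    ∃ Λ : ℕ → Finset MultiIndex,
      Monotone Λ ∧
      (∀ N : ℕ, IsLowerSet (Λ N : Set MultiIndex)) ∧
      (∀ N : ℕ, (Λ N).card = N) ∧
      ∃ C : ℝ, ∀ N : ℕ,
        eLpNorm (fun x => extendZero f x - sparseColloc ξ (Λ N) (extendZero f) x) 2 gaussianProd
          ≤ ENNReal.ofReal (C * ((N : ℝ) + 1) ^ (-(1 / p - 1))) := by
  have hnn := nonneg_of_antitone_of_summable_rpow hanti hp0 hsum
  have hfin : ∀ ε > 0, {ν | ε ≤ chat ν}.Finite := fun ε hε => by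
    simpa only [abs_of_nonneg (hnn _)] using finite_setOf_le_of_summable_rpow hp0 hsum hε
  simp only [abs_of_nonneg (hnn _)] at hsum
  obtain ⟨Λ, hmono, hlower, hcard, hlargest⟩ := exists_nested_largest hanti hnn hfin
  have hstechkin := fun N =>
    tsum_indicator_compl_le_stechkin hnn hp0 hp1 hsum (s := Λ N) (hlargest N)
  -- Stechkin's bound for the empty set `Λ 0` is the finiteness of the full sum of `chat`, which
  -- dominates the coefficients because the worst-case errors are at least one.
  have hcoeff : ∑' ν, ‖hermiteCoeff f ν‖ₑ ≠ ⊤ := by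
    refine ne_top_of_le_ne_top ENNReal.ofReal_ne_top
      (le_trans (ENNReal.tsum_le_tsum fun ν => ?_) (hstechkin 0))
    rw [Finset.card_eq_zero.1 (hcard 0)]
    simpa using (le_mul_of_one_le_left' (one_le_worstError ν)).trans (hbound ν)
  have hgridsum : ∀ k : MultiIndex, ∀ y ∈ tensorGrid ξ k,
      HasSum (fun ν => multiHermite ν y • hermiteCoeff f ν) (extendZero f y) := by
    intro k y hy
    have hval : extendZero f y = f ⟨y, hgrid k hy⟩ :=
      Subtype.val_injective.extend_apply f 0 ⟨y, hgrid k hy⟩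
    rw [hval]
    exact hexp k ⟨y, hgrid k hy⟩ hy
  refine ⟨Λ, hmono, hlower, hcard, (∑' ν, chat ν ^ p) ^ (1 / p), fun N => ?_⟩
  have h := eLpNorm_sub_sparseColloc_le hξ (ae_hasSum_hermite hf (fun _ => rfl) hcoeff) hgridsum
    (hlower N)
  refine h.trans ((ENNReal.tsum_le_tsum fun ν => ?_).trans ((hstechkin N).trans_eq ?_))
  · exact Set.indicator_le_indicator (hbound ν)
  · rw [hcard]
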